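/- Let $n\ge 1$, $0<\tau_1<\tau_2<1$ and $0<\nu<1$. There is a constant $\beta_0>0$, depending only on $n,\tau_1,\tau_2,\nu$, such that the following holds for every $\alpha>0$, with $\beta:=\min\{\beta_0,\alpha\}$, so that $0<\beta\le\alpha$. Write $B(y,s)$ for the open ball of radius $s$ about $y$ and $B_1=B(0,1)$. Let $\Omega\subset\mathbb{R}^n$ be a bounded domain with $0\in\partial\Omega$ that satisfies the uniform condition at $0$ with constants $\tau_1,\tau_2,\nu$ and $r_0=1$: there is a sequence of positive radii $(r_k)_{k\ge 0}$ with $r_0=1$ and $$\tau_1 r_{k-1}\le r_k\le \tau_2 r_{k-1}\qquad\text{for all } k\ge 1,$$ and for every $k\ge 0$ there is $y_k\in\partial B(0,r_k)$ with $$\partial B(0,r_k)\cap B(y_k,\nu r_k)\subset\Omega^c .$$ Let $g:\partial\Omega\cap B_1\to\mathbb{R}$ be $C^\alpha$ at $0$, i.e. there is $K\ge 0$ with $|g(x)-g(0)|\le K|x|^\alpha$ for all $x\in\partial\Omega\cap B_1$, and let $[g]_{C^\alpha(0)}$ be the infimum of such $K$. Let $u:\overline\Omega\cap B_1\to\mathbb{R}$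 be continuous, bounded on $\Omega\cap B_1$, equal to $g$ on $\partial\Omega\cap B_1$, and a viscosity solution of $$\Delta_\infty u=\sum_{i,j=1}^n u_{x_i}u_{x_j}u_{x_ix_j}=0\qquad\text{in }\Omega\cap B_1;$$ that is, for every $x\in\Omega\cap B_1$ and every $\varphi$ of class $C^2$ near $x$, one has $\Delta_\infty\varphi(x)\ge 0$ if $u-\varphi$ has a local maximum at $x$, and $\Delta_\infty\varphi(x)\le 0$ if $u-\varphi$ has a local minimum at $x$. Then $u$ is $C^\beta$ at $0$, i.e. there is $K\ge 0$ with $|u(x)-u(0)|\le K|x|^\beta$ for all $x\in\overline\Omega\cap B_1$, and $$|u(x)-u(0)|\le 8|x|^\beta\left(\|u\|_{L^\infty(\Omega\cap B_1)}+[g]_{C^\alpha(0)}\right)\qquad\text{for all }x\in\Omega\cap B_1 .$$ -/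

import Mathlib

open MeasureTheory Metric Set
open scoped ENNReal

/-- The partial derivative `∂f/∂x_i` at `x`. -/
noncomputable def partialDeriv {n : ℕ} (i : Fin n) (f : EuclideanSpace ℝ (Fin n) → ℝ)
    (x : EuclideanSpace ℝ (Fin n)) : ℝ :=
  fderiv ℝ f x (EuclideanSpace.single i 1)

/-- The infinity Laplacian `Δ_∞ φ = ∑_{i,j} φ_i φ_j φ_{ij}`. -/
noncomputable def infinityLaplacian {n : ℕ} (φ : EuclideanSpace ℝ (Fin n) → ℝ)
    (x : EuclideanSpace ℝ (Fin n)) : ℝ :=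
  ∑ i : Fin n, ∑ j : Fin n,
    partialDeriv i φ x * partialDeriv j φ x * partialDeriv i (partialDeriv j φ) x

/-- `u` is a viscosity solution of `Δ_∞ u = 0` in the open set `U`. The test functions are those of
class `C²` in a neighbourhood of the point of contact. -/
structure IsInfinityHarmonic {n : ℕ} (U : Set (EuclideanSpace ℝ (Fin n)))
    (u : EuclideanSpace ℝ (Fin n) → ℝ) : Prop where
  continuousOn : ContinuousOn u U
  subsolution : ∀ x ∈ U, ∀ φ : EuclideanSpace ℝ (Fin n) → ℝ, ContDiffAt ℝ 2 φ x →
    IsLocalMax (fun y => u y - φ y) x → 0 ≤ infinityLaplacian φ x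
  supersolution : ∀ x ∈ U, ∀ φ : EuclideanSpace ℝ (Fin n) → ℝ, ContDiffAt ℝ 2 φ x →
    IsLocalMin (fun y => u y - φ y) x → infinityLaplacian φ x ≤ 0

/-- `u` is a viscosity solution of `Δ_∞ u = 0` in `Ω ∩ B₁`, `u = g` on `∂Ω ∩ B₁`: it is defined and
continuous on `closure Ω ∩ B₁`, so that the boundary values are attained continuously. -/
structure IsLocalDirichletSolution {n : ℕ} (Ω : Set (EuclideanSpace ℝ (Fin n)))
    (g u : EuclideanSpace ℝ (Fin n) → ℝ) : Prop where
  continuousOn : ContinuousOn u (closure Ω ∩ ball 0 1)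
  infinityHarmonic : IsInfinityHarmonic (Ω ∩ ball 0 1) u
  boundary : ∀ x ∈ frontier Ω ∩ ball 0 1, u x = g x

/-- The uniform condition at `x₀` for the set `Ω`, with constants `τ₁, τ₂, ν` and radii `r k`. -/
structure UniformConditionAt {n : ℕ} (Ω : Set (EuclideanSpace ℝ (Fin n)))
    (x₀ : EuclideanSpace ℝ (Fin n)) (τ₁ τ₂ ν : ℝ) (r : ℕ → ℝ) : Prop where
  tau₁_pos : 0 < τ₁
  tau₁_lt_tau₂ : τ₁ < τ₂
  tau₂_lt_one : τ₂ < 1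
  nu_pos : 0 < ν
  nu_lt_one : ν < 1
  radius_pos : ∀ k, 0 < r k
  radius_ratio : ∀ k, τ₁ * r k ≤ r (k + 1) ∧ r (k + 1) ≤ τ₂ * r k
  cap : ∀ k, ∃ y ∈ sphere x₀ (r k), sphere x₀ (r k) ∩ ball y (ν * r k) ⊆ Ωᶜ

/-- The constants `K ≥ 0` with `|f x - f x₀| ≤ K |x - x₀|^α` for all `x` in the domain `S` of
`f`. -/
def pointHolderConstants {n : ℕ} (S : Set (EuclideanSpace ℝ (Fin n)))
    (f : EuclideanSpace ℝ (Fin n) → ℝ) (α : ℝ) (x₀ : EuclideanSpace ℝ (Fin n)) : Set ℝ :=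
  {K : ℝ | 0 ≤ K ∧ ∀ x ∈ S, |f x - f x₀| ≤ K * ‖x - x₀‖ ^ α}

/-- `f`, as a function on `S`, is `C^α` at `x₀`. -/
def IsPointHolder {n : ℕ} (S : Set (EuclideanSpace ℝ (Fin n)))
    (f : EuclideanSpace ℝ (Fin n) → ℝ) (α : ℝ) (x₀ : EuclideanSpace ℝ (Fin n)) : Prop :=
  (pointHolderConstants S f α x₀).Nonempty

/-- The seminorm `[f]_{C^α(x₀)}` of `f` as a function on `S`. -/
noncomputable def pointHolderSeminorm {n : ℕ} (S : Set (EuclideanSpace ℝ (Fin n)))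
    (f : EuclideanSpace ℝ (Fin n) → ℝ) (α : ℝ) (x₀ : EuclideanSpace ℝ (Fin n)) : ℝ :=
  sInf (pointHolderConstants S f α x₀)

/-! The proof is a barrier argument. For a radial function `F(|x|)` one has `Δ_∞ = F'² F''` away
from the origin, so the concave power `C|x|^β`, `0 < β < 1`, is a strict supersolution there, in
every dimension. Its only singularity, the origin, lies on `∂Ω`, hence outside the open set `Ω`. Let
`N` be the sup norm of `u` and `G` the seminorm of `g`. For `C > 2N + G` the barrier dominates `u -
u(0)` on `∂Ω ∩ B₁` and near `|x| = 1`, and an interior maximum of `u - C|x|^β` would contradict the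
subsolution test. The same bound for `-u`, then `C → 2N + G`, gives the estimate. -/

theorem partialDeriv_comp_norm_sq {n : ℕ} (i : Fin n) {h : ℝ → ℝ} {h' : ℝ}
    {x : EuclideanSpace ℝ (Fin n)} (hh : HasDerivAt h h' (‖x‖ ^ 2)) :
    partialDeriv i (fun y => h (‖y‖ ^ 2)) x = 2 * h' * x i := by
  have h1 := hh.comp_hasFDerivAt x (hasStrictFDerivAt_norm_sq x).hasFDerivAt
  have h2 : fderiv ℝ (fun y : EuclideanSpace ℝ (Fin n) => h (‖y‖ ^ 2)) x = _ := h1.fderiv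
  rw [partialDeriv, h2]
  simp [EuclideanSpace.inner_single_right]
  ring

theorem partialDeriv_partialDeriv_comp_norm_sq {n : ℕ} (i j : Fin n) {h h' : ℝ → ℝ} {h'' : ℝ}
    {x : EuclideanSpace ℝ (Fin n)} (hh : ∀ᶠ s in nhds (‖x‖ ^ 2), HasDerivAt h (h' s) s)
    (hh' : HasDerivAt h' h'' (‖x‖ ^ 2)) :
    partialDeriv i (partialDeriv j (fun y => h (‖y‖ ^ 2))) x =
      4 * h'' * x i * x j + 2 * h' (‖x‖ ^ 2) * (if i = j then 1 else 0) := by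
  have hc : Filter.Tendsto (fun y : EuclideanSpace ℝ (Fin n) => ‖y‖ ^ 2) (nhds x)
      (nhds (‖x‖ ^ 2)) := by
    apply Continuous.tendsto
    fun_prop
  have he : partialDeriv j (fun y => h (‖y‖ ^ 2)) =ᶠ[nhds x] fun y => 2 * h' (‖y‖ ^ 2) * y j := by
    filter_upwards [hc.eventually hh] with y hy
    exact partialDeriv_comp_norm_sq j hy
  have h1 := ((hh'.comp_hasFDerivAt x (hasStrictFDerivAt_norm_sq x).hasFDerivAt).const_mul 2).mul
    (EuclideanSpace.proj j : EuclideanSpace ℝ (Fin n) →L[ℝ] ℝ).hasFDerivAt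
  have h2 : fderiv ℝ (fun y : EuclideanSpace ℝ (Fin n) => 2 * h' (‖y‖ ^ 2) * y j) x = _ :=
    h1.fderiv
  rw [partialDeriv, he.fderiv_eq, h2]
  simp [EuclideanSpace.inner_single_right, eq_comm]
  split_ifs <;> ring

/-- The gradient is `2h'x` and the Hessian `4h'' x⊗x + 2h' I`; only the second derivative along `x`
survives. -/
theorem infinityLaplacian_comp_norm_sq {n : ℕ} {h h' : ℝ → ℝ} {h'' : ℝ}
    {x : EuclideanSpace ℝ (Fin n)} (hh : ∀ᶠ s in nhds (‖x‖ ^ 2), HasDerivAt h (h' s) s)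
    (hh' : HasDerivAt h' h'' (‖x‖ ^ 2)) :
    infinityLaplacian (fun y => h (‖y‖ ^ 2)) x =
      4 * h' (‖x‖ ^ 2) ^ 2 * (4 * h'' * (‖x‖ ^ 2) ^ 2 + 2 * h' (‖x‖ ^ 2) * ‖x‖ ^ 2) := by
  have hs : ‖x‖ ^ 2 = ∑ i, x i ^ 2 := EuclideanSpace.real_norm_sq_eq x
  simp only [infinityLaplacian, partialDeriv_comp_norm_sq _ hh.self_of_nhds,
    partialDeriv_partialDeriv_comp_norm_sq _ _ hh hh']
  generalize h' (‖x‖ ^ 2) = a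
  rw [hs]
  have : ∀ i j : Fin n, 2 * a * x i * (2 * a * x j) *
      (4 * h'' * x i * x j + 2 * a * (if i = j then 1 else 0)) =
      16 * a ^ 2 * h'' * (x i ^ 2 * x j ^ 2) + if i = j then 8 * a ^ 3 * x j ^ 2 else 0 := by
    intro i j
    split_ifs with hij
    · subst hij; ring
    · ring
  simp only [this, Finset.sum_add_distrib, Finset.sum_ite_eq, Finset.mem_univ, if_true,
    ← Finset.mul_sum, ← Finset.sum_mul]
  ring

theorem norm_rpow_eq_norm_sq_rpow {E : Type*} [SeminormedAddCommGroup E] (β : ℝ) (y : E) :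
    ‖y‖ ^ β = (‖y‖ ^ 2) ^ (β / 2) := by
  rw [← Real.rpow_natCast, ← Real.rpow_mul (norm_nonneg y)]
  congr 1
  push_cast
  ring

/-- The powers `C ‖y‖ ^ β` with `0 < β < 1` are strict supersolutions away from the origin. -/
theorem infinityLaplacian_mul_norm_rpow_neg {n : ℕ} {C β : ℝ} (hC : 0 < C) (hβ₀ : 0 < β)
    (hβ₁ : β < 1) {x : EuclideanSpace ℝ (Fin n)} (hx : x ≠ 0) :
    infinityLaplacian (fun y => C * ‖y‖ ^ β) x < 0 := by
  have hs : 0 < ‖x‖ ^ 2 := by positivity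
  have hh : ∀ᶠ s in nhds (‖x‖ ^ 2),
      HasDerivAt (fun s : ℝ => C * s ^ (β / 2)) (C * (β / 2 * s ^ (β / 2 - 1))) s := by
    filter_upwards [lt_mem_nhds hs] with s hs
    exact (Real.hasDerivAt_rpow_const (Or.inl hs.ne')).const_mul C
  have hh' : HasDerivAt (fun s : ℝ => C * (β / 2 * s ^ (β / 2 - 1)))
      (C * (β / 2 * ((β / 2 - 1) * (‖x‖ ^ 2) ^ (β / 2 - 1 - 1)))) (‖x‖ ^ 2) :=
    ((Real.hasDerivAt_rpow_const (Or.inl hs.ne')).const_mul _).const_mul C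
  have key := infinityLaplacian_comp_norm_sq hh hh'
  simp only [norm_rpow_eq_norm_sq_rpow β]
  rw [key]
  generalize ‖x‖ ^ 2 = s at hs
  rw [Real.rpow_sub_one hs.ne' (β / 2 - 1)]
  have hp : 0 < s ^ (β / 2 - 1) := by positivity
  generalize s ^ (β / 2 - 1) = p at hp
  -- This factor carries the sign: it is negative because `t ^ β` is concave.
  have : 4 * (C * (β / 2 * ((β / 2 - 1) * (p / s)))) * s ^ 2 + 2 * (C * (β / 2 * p)) * s =
      -(C * β * p * s * (1 - β)) := by
    field_simp
    ring
  rw [this, mul_neg, neg_lt_zero]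
  have : 0 < 1 - β := sub_pos.2 hβ₁
  positivity

theorem IsInfinityHarmonic.neg {n : ℕ} {U : Set (EuclideanSpace ℝ (Fin n))}
    {u : EuclideanSpace ℝ (Fin n) → ℝ} (hu : IsInfinityHarmonic U u) :
    IsInfinityHarmonic U (fun x => -u x) := by
  have hneg : ∀ (φ : EuclideanSpace ℝ (Fin n) → ℝ) x,
      infinityLaplacian (fun y => -φ y) x = -infinityLaplacian φ x := by
    intro φ x
    have h1 : ∀ (i : Fin n) (f : EuclideanSpace ℝ (Fin n) → ℝ),
        partialDeriv i (fun y => -f y) = fun y => -partialDeriv i f y := by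
      intro i f
      funext y
      simp [partialDeriv, fderiv_fun_neg]
    simp only [infinityLaplacian, h1, ← Finset.sum_neg_distrib]
    refine Finset.sum_congr rfl fun i _ => Finset.sum_congr rfl fun j _ => by ring
  refine ⟨hu.continuousOn.neg, fun x hx φ hφ hm => ?_, fun x hx φ hφ hm => ?_⟩
  · have := hu.supersolution x hx (fun y => -φ y) hφ.neg
      (hm.neg.congr (Filter.Eventually.of_forall fun y => by simp; ring))
    rw [hneg] at this
    linarith
  · have := hu.subsolution x hx (fun y => -φ y) hφ.neg
      (hm.neg.congr (Filter.Eventually.of_forall fun y => by simp; ring))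
    rw [hneg] at this
    linarith

/-- Comparison of an infinity harmonic function with the barrier `C ‖x‖ ^ β`. -/
theorem IsInfinityHarmonic.sub_le_mul_norm_rpow {n : ℕ} {Ω : Set (EuclideanSpace ℝ (Fin n))}
    (hΩ : IsOpen Ω) (h0 : (0 : EuclideanSpace ℝ (Fin n)) ∈ frontier Ω)
    {u : EuclideanSpace ℝ (Fin n) → ℝ} (hc : ContinuousOn u (closure Ω ∩ ball 0 1))
    (hu : IsInfinityHarmonic (Ω ∩ ball 0 1) u) {β C : ℝ} (hβ₀ : 0 < β) (hβ₁ : β < 1)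
    (hC : 0 < C) {c M : ℝ} (hM : ∀ x ∈ Ω ∩ ball 0 1, u x - c ≤ M) (hMC : M < C)
    (hb : ∀ x ∈ frontier Ω ∩ ball 0 1, u x - c ≤ C * ‖x‖ ^ β) :
    ∀ x ∈ Ω ∩ ball 0 1, u x - c ≤ C * ‖x‖ ^ β := by
  intro x hx
  have h0Ω : (0 : EuclideanSpace ℝ (Fin n)) ∉ Ω := by
    rw [hΩ.frontier_eq] at h0
    exact h0.2
  have hx1 : ‖x‖ < 1 := by simpa using hx.2
  -- Nothing is known about `u` on the unit sphere; the slack `M < C` lets a slightly smaller sphere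
  -- serve instead.
  obtain ⟨ρ, hxρ, hρ1, hρ⟩ : ∃ ρ, ‖x‖ < ρ ∧ ρ < 1 ∧ M < C * ρ ^ β := by
    have hcont : Filter.Tendsto (fun ρ : ℝ => C * ρ ^ β) (nhdsWithin 1 (Iio 1)) (nhds C) := by
      have : ContinuousAt (fun ρ : ℝ => C * ρ ^ β) 1 :=
        (Real.continuousAt_rpow_const 1 β (Or.inl one_ne_zero)).const_mul C
      simpa [ContinuousAt] using this.tendsto.mono_left nhdsWithin_le_nhds
    have h1 := hcont.eventually (lt_mem_nhds hMC)
    have h2 : ∀ᶠ ρ : ℝ in nhdsWithin 1 (Iio 1), ‖x‖ < ρ :=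
      nhdsWithin_le_nhds (lt_mem_nhds hx1)
    have h3 : ∀ᶠ ρ : ℝ in nhdsWithin 1 (Iio 1), ρ < 1 := self_mem_nhdsWithin
    obtain ⟨ρ, ha, hb, hc⟩ := (h1.and (h2.and h3)).exists
    exact ⟨ρ, hb, hc, ha⟩
  set S := closure Ω ∩ closedBall (0 : EuclideanSpace ℝ (Fin n)) ρ with hS
  have hSsub : S ⊆ closure Ω ∩ ball 0 1 :=
    inter_subset_inter_right _ (closedBall_subset_ball hρ1)
  have hScpt : IsCompact S := (isCompact_closedBall _ _).inter_left isClosed_closure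
  have hxS : x ∈ S := ⟨subset_closure hx.1, by simpa using hxρ.le⟩
  have hφc : Continuous fun y : EuclideanSpace ℝ (Fin n) => C * ‖y‖ ^ β :=
    continuous_const.mul (continuous_norm.rpow_const fun _ => Or.inr hβ₀.le)
  obtain ⟨z, hzS, hz⟩ := hScpt.exists_isMaxOn ⟨x, hxS⟩
    ((hc.mono hSsub).sub hφc.continuousOn)
  suffices hzle : u z - c ≤ C * ‖z‖ ^ β by
    have : u x - C * ‖x‖ ^ β ≤ u z - C * ‖z‖ ^ β := hz hxS
    linarith
  by_cases hzΩ : z ∈ Ω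
  · have hzb : z ∈ Ω ∩ ball 0 1 := ⟨hzΩ, (hSsub hzS).2⟩
    have hzρ : ‖z‖ ≤ ρ := by simpa using hzS.2
    rcases hzρ.lt_or_eq with hlt | heq
    · exfalso
      have hz0 : z ≠ 0 := fun h => h0Ω (h ▸ hzΩ)
      have hzn : ‖z‖ ≠ 0 := norm_ne_zero_iff.2 hz0
      have hloc : IsLocalMax (fun y => u y - C * ‖y‖ ^ β) z := by
        refine hz.isLocalMax ?_
        have hopen : IsOpen (Ω ∩ ball 0 ρ) := hΩ.inter isOpen_ball
        exact Filter.mem_of_superset (hopen.mem_nhds ⟨hzΩ, by simpa using hlt⟩)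
          (inter_subset_inter subset_closure ball_subset_closedBall)
      have hsm : ContDiffAt ℝ 2 (fun y : EuclideanSpace ℝ (Fin n) => C * ‖y‖ ^ β) z :=
        contDiffAt_const.mul ((contDiffAt_norm ℝ hz0).rpow_const_of_ne hzn)
      exact (infinityLaplacian_mul_norm_rpow_neg hC hβ₀ hβ₁ hz0).not_ge
        (hu.subsolution z hzb _ hsm hloc)
    · rw [heq]
      exact (hM z hzb).trans hρ.le
  · exact hb z ⟨by rw [hΩ.frontier_eq]; exact ⟨hzS.1, hzΩ⟩, (hSsub hzS).2⟩

/-- On an open set a continuous essentially bounded function is bounded by its `L^∞` norm. -/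
theorem abs_le_eLpNorm_top_of_continuousOn {X : Type*} [TopologicalSpace X] [MeasurableSpace X]
    [OpensMeasurableSpace X] {μ : Measure X} [μ.IsOpenPosMeasure] {U : Set X} (hU : IsOpen U)
    {u : X → ℝ} (hc : ContinuousOn u U) (hu : MemLp u ∞ (μ.restrict U)) {x : X} (hx : x ∈ U) :
    |u x| ≤ (eLpNorm u ∞ (μ.restrict U)).toReal := by
  set N := (eLpNorm u ∞ (μ.restrict U)).toReal
  have hae : ∀ᵐ y ∂μ.restrict U, |u y| ≤ N := by
    filter_upwards [enorm_ae_le_eLpNormEssSup u (μ.restrict U)] with y hy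
    rw [← eLpNorm_exponent_top] at hy
    have := ENNReal.toReal_mono hu.2.ne hy
    rwa [toReal_enorm, Real.norm_eq_abs] at this
  -- The exceptional set is open and null, hence empty.
  have hV : IsOpen (U ∩ u ⁻¹' {t | N < |t|}) :=
    hc.isOpen_inter_preimage hU (isOpen_lt continuous_const continuous_abs)
  have hzero : μ (U ∩ u ⁻¹' {t | N < |t|}) = 0 := by
    rw [ae_restrict_iff' hU.measurableSet] at hae
    refine measure_mono_null ?_ (ae_iff.1 hae)
    rintro y ⟨hyU, hy⟩
    simpa [hyU] using hy
  rw [hV.measure_eq_zero_iff μ] at hzero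
  by_contra! hlt
  exact (hzero ▸ (⟨hx, hlt⟩ : x ∈ U ∩ u ⁻¹' {t | N < |t|}) : x ∈ (∅ : Set X))

/-- The admissible constants form a closed set bounded below, so the infimum is attained. -/
theorem pointHolderSeminorm_mem {n : ℕ} {S : Set (EuclideanSpace ℝ (Fin n))}
    {f : EuclideanSpace ℝ (Fin n) → ℝ} {α : ℝ} {x₀ : EuclideanSpace ℝ (Fin n)}
    (hf : IsPointHolder S f α x₀) :
    pointHolderSeminorm S f α x₀ ∈ pointHolderConstants S f α x₀ := by
  refine IsClosed.csInf_mem ?_ hf ⟨0, fun K hK => hK.1⟩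
  have : pointHolderConstants S f α x₀ =
      Ici 0 ∩ ⋂ x ∈ S, {K : ℝ | |f x - f x₀| ≤ K * ‖x - x₀‖ ^ α} := by
    ext K
    simp [pointHolderConstants]
  rw [this]
  exact isClosed_Ici.inter (isClosed_biInter fun x _ =>
    isClosed_le continuous_const (continuous_id.mul continuous_const))

theorem IsLocalDirichletSolution.abs_sub_le {n : ℕ} {Ω : Set (EuclideanSpace ℝ (Fin n))}
    (hΩ : IsOpen Ω) (h0 : (0 : EuclideanSpace ℝ (Fin n)) ∈ frontier Ω)
    {g u : EuclideanSpace ℝ (Fin n) → ℝ} (hu : IsLocalDirichletSolution Ω g u) {α β : ℝ}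
    (hβ₀ : 0 < β) (hβ₁ : β < 1) (hβα : β ≤ α)
    (hg : IsPointHolder (frontier Ω ∩ ball 0 1) g α 0)
    (hb : MemLp u ∞ (volume.restrict (Ω ∩ ball 0 1))) :
    ∀ x ∈ closure Ω ∩ ball 0 1, |u x - u 0| ≤
      (2 * (eLpNorm u ∞ (volume.restrict (Ω ∩ ball 0 1))).toReal +
        pointHolderSeminorm (frontier Ω ∩ ball 0 1) g α 0) * ‖x‖ ^ β := by
  obtain ⟨hG0, hG⟩ := pointHolderSeminorm_mem hg
  set G := pointHolderSeminorm (frontier Ω ∩ ball 0 1) g α 0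
  have hbd : ∀ x ∈ Ω ∩ ball 0 1, |u x| ≤ _ := fun x hx =>
    abs_le_eLpNorm_top_of_continuousOn (hΩ.inter isOpen_ball) hu.infinityHarmonic.continuousOn
      hb hx
  have hN0 : 0 ≤ (eLpNorm u ∞ (volume.restrict (Ω ∩ ball 0 1))).toReal := ENNReal.toReal_nonneg
  set N := (eLpNorm u ∞ (volume.restrict (Ω ∩ ball 0 1))).toReal
  have h0b : (0 : EuclideanSpace ℝ (Fin n)) ∈ ball 0 1 := mem_ball_self one_pos
  -- The bound passes to the boundary point `0` by continuity.
  have hu0 : |u 0| ≤ N := by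
    have hcl : (0 : EuclideanSpace ℝ (Fin n)) ∈ closure (Ω ∩ ball 0 1) := by
      rw [inter_comm]
      exact isOpen_ball.inter_closure ⟨h0b, h0.1⟩
    have hcw : ContinuousWithinAt u (Ω ∩ ball 0 1) 0 :=
      (hu.continuousOn 0 ⟨h0.1, h0b⟩).mono (inter_subset_inter_left _ subset_closure)
    have hmem := hcw.mem_closure hcl (t := {t : ℝ | |t| ≤ N}) hbd
    rwa [(isClosed_le continuous_abs continuous_const).closure_eq] at hmem
  have hfr : ∀ x ∈ frontier Ω ∩ ball 0 1, |u x - u 0| ≤ G * ‖x‖ ^ β := by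
    intro x hx
    rw [hu.boundary x hx, hu.boundary 0 ⟨h0, h0b⟩]
    refine (hG x hx).trans (mul_le_mul_of_nonneg_left ?_ hG0)
    rw [sub_zero]
    exact Real.rpow_le_rpow_of_exponent_ge_of_imp (norm_nonneg x)
      (mem_ball_zero_iff.1 hx.2).le hβα fun _ h => absurd h (hβ₀.trans_le hβα).ne'
  intro x hx
  have hxβ : 0 ≤ ‖x‖ ^ β := Real.rpow_nonneg (norm_nonneg x) β
  by_cases hxΩ : x ∈ Ω
  -- A strictly larger `C` ensures `C > 0` and `2N < C`, even when `N = G = 0`.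
  · have hC : ∀ C, 2 * N + G < C → |u x - u 0| ≤ C * ‖x‖ ^ β := by
      intro C hC
      have hosc : ∀ y ∈ Ω ∩ ball 0 1, |u y - u 0| ≤ 2 * N := fun y hy =>
        (abs_sub _ _).trans (by linarith [hbd y hy])
      have hfrC : ∀ y ∈ frontier Ω ∩ ball 0 1, |u y - u 0| ≤ C * ‖y‖ ^ β := fun y hy =>
        (hfr y hy).trans (mul_le_mul_of_nonneg_right (by linarith)
          (Real.rpow_nonneg (norm_nonneg y) β))
      have h1 := hu.infinityHarmonic.sub_le_mul_norm_rpow hΩ h0 hu.continuousOn hβ₀ hβ₁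
        (by linarith) (c := u 0) (fun y hy => (abs_le.1 (hosc y hy)).2) (by linarith)
        (fun y hy => (abs_le.1 (hfrC y hy)).2) x ⟨hxΩ, hx.2⟩
      have h2 := IsInfinityHarmonic.sub_le_mul_norm_rpow (u := fun y => -u y) hΩ h0
        hu.continuousOn.neg hu.infinityHarmonic.neg hβ₀ hβ₁ (C := C) (M := 2 * N) (by linarith) (c := -u 0)
        (fun y hy => by linarith [(abs_le.1 (hosc y hy)).1]) (by linarith)
        (fun y hy => by linarith [(abs_le.1 (hfrC y hy)).1]) x ⟨hxΩ, hx.2⟩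
      exact abs_le.2 ⟨by linarith, h1⟩
    refine ge_of_tendsto (x := nhdsWithin (2 * N + G) (Ioi (2 * N + G)))
      (f := fun C => C * ‖x‖ ^ β) ?_ ?_
    · exact ((continuous_id.mul continuous_const).tendsto _).mono_left nhdsWithin_le_nhds
    · filter_upwards [self_mem_nhdsWithin] with C h using hC C h
  · refine (hfr x ⟨by rw [hΩ.frontier_eq]; exact ⟨hx.1, hxΩ⟩, hx.2⟩).trans ?_
    gcongr
    linarith

theorem theorem1p1 (n : ℕ) (τ₁ τ₂ ν : ℝ) (hτ₁ : 0 < τ₁) (hτ₁₂ : τ₁ < τ₂) (hτ₂ : τ₂ < 1)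
    (hν₀ : 0 < ν) (hν₁ : ν < 1) :
    ∃ β₀ : ℝ, 0 < β₀ ∧
      ∀ (α : ℝ) (_ : 0 < α)
        (Ω : Set (EuclideanSpace ℝ (Fin n))) (_ : IsOpen Ω) (_ : IsConnected Ω)
        (_ : Bornology.IsBounded Ω) (_ : (0 : EuclideanSpace ℝ (Fin n)) ∈ frontier Ω)
        (r : ℕ → ℝ) (_ : r 0 = 1) (_ : UniformConditionAt Ω 0 τ₁ τ₂ ν r)
        (g u : EuclideanSpace ℝ (Fin n) → ℝ)
        (_ : IsPointHolder (frontier Ω ∩ ball 0 1) g α 0)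
        (_ : IsLocalDirichletSolution Ω g u)
        (_ : MemLp u ∞ (volume.restrict (Ω ∩ ball 0 1))),
        IsPointHolder (closure Ω ∩ ball 0 1) u (min β₀ α) 0 ∧
        ∀ x ∈ Ω ∩ ball 0 1,
          |u x - u 0| ≤ 8 * ‖x‖ ^ (min β₀ α) *
            ((eLpNorm u ∞ (volume.restrict (Ω ∩ ball 0 1))).toReal +
              pointHolderSeminorm (frontier Ω ∩ ball 0 1) g α 0) := by
  -- Any number in `(0, 1)` would do: the barrier only needs an exponent below 1.
  refine ⟨1 / 2, by norm_num, ?_⟩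
  intro α hα Ω hΩ _ _ h0 r _ _ g u hg hu hb
  have hβ₀ : 0 < min (1 / 2) α := lt_min (by norm_num) hα
  have hβ₁ : min (1 / 2) α < 1 := (min_le_left _ _).trans_lt (by norm_num)
  have key := hu.abs_sub_le hΩ h0 hβ₀ hβ₁ (min_le_right _ _) hg hb
  have hG0 := (pointHolderSeminorm_mem hg).1
  have hN0 : 0 ≤ (eLpNorm u ∞ (volume.restrict (Ω ∩ ball 0 1))).toReal := ENNReal.toReal_nonneg
  refine ⟨⟨_, add_nonneg (mul_nonneg zero_le_two hN0) hG0,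
    fun x hx => by rw [sub_zero]; exact key x hx⟩, fun x hx => ?_⟩
  refine (key x ⟨subset_closure hx.1, hx.2⟩).trans ?_
  rw [mul_comm, mul_comm 8, mul_assoc]
  exact mul_le_mul_of_nonneg_left (by linarith) (Real.rpow_nonneg (norm_nonneg x) _)
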